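/- **Setting.** Let $\mathcal U,\mathcal X,\mathcal Y,\mathcal W$ be finite alphabets, $\mathcal P_U,\mathcal P_X$ probability distributions on $\mathcal U,\mathcal X$, $\mathcal P_{W|U,X}$ a conditional distribution, and $\mathcal W(y\mid x,y')$ the transition law of a Markov channel with input $x$, previous output $y'$ and output $y$. Let $\pi$ be an equilibrium distribution of the output chain under i.i.d. inputs, i.e. $\pi(y)=\sum_{x,y'}\pi(y')\mathcal P_X(x)\mathcal W(y|x,y')$. Let $(U,X,W,Y',Y)$ have law $\mathcal P_U\mathcal P_X\mathcal P_{W|U,X}\,\pi_{Y'}\,\mathcal W_{Y|X,Y'}$, write $\mathcal P_{U,X,W}$, $\mathcal P_{W|X}$, $\mathcal P_{Y'XY}$, $\mathcal P_{WY'XY}$ for its marginals and conditionals, and let $I(X;Y|Y')$ (in bits) be computed under it. A sequence $z^n$ is in $\mathcal T^{(n)}_\varepsilon(P)$ if its empirical distribution is within $\ell_1$-distance $\varepsilon$ of $P$. For a statement about $(Y',X,Y)$ or $(W,Y',X,Y)$ the symbol at time $t$ is $(y_{t-1},x_t,y_t)$ or $(w_t,y_{t-1},x_t,y_t)$, where $y_0$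 denotes the channel state just before the block (input-driven Markov typicality). **Block-Markov random code.** There are $B$ blocks of length $n$, and $\mathcal M$ has $\lceil 2^{nR}\rceil$ elements. The codewords $X^n(m)$, $m\in\mathcal M$, are independent with law $\mathcal P_X^{\otimes n}$; given them, the sequences $W^n(m,\hat m)$, $m,\hat m\in\mathcal M$, are independent with laws $\prod_t\mathcal P_{W|X}(\cdot\mid X_t(m))$. The source blocks $U_1^n,\dots,U_B^n$ are i.i.d. with law $\mathcal P_U$, independent of the codebook. The first message $m_1$ is a fixed element of $\mathcal M$. For $b\ge2$ the message $m_b$ is chosen from the set of all $\hat m$ with $(U_{b-1}^n,X^n(m_{b-1}),W^n(m_{b-1},\hat m))\in\mathcal T^{(n)}_\varepsilon(\mathcal P_{U,X,W})$, by some fixed deterministic rule that depends on $b$, $m_{b-1}$ and this set only; the rule picks a member of the set when it is non-empty and an arbitrary index otherwise. In block $b$ the word $X^n(m_b)$ is sent over the channel, whose initial state is $Y_{b-1,n}$, the last output of block $b-1$ (an arbitrary fixed $y_0$ for $b=1$); this produces $Y_b^n$. Define $$A_b(\tilde m)=\{(Y_b^n,X^n(\tilde m))\in\mathcal T^{(n)}_\varepsilon(\mathcal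 P_{Y'XY})\},$$ $$B_b(\tilde m)=\{(Y_b^n,X^n(m_b),W^n(m_b,\tilde m))\in\mathcal T^{(n)}_\varepsilon(\mathcal P_{WY'XY})\}.$$ Let $\mathbb E_c$ denote expectation over the random codebook $c$, and $\mathbb P$ probability given $c$. **Joint Packing Lemma.** Let $\delta>0$, $R>0$ and $R\le I(X;Y|Y')-\delta$. Then there is $\varepsilon_0>0$ such that for every typicality parameter $0<\varepsilon<\varepsilon_0$ and every $\eta>0$ there is $N_0$ such that for all $n\ge N_0$, every number of blocks $B$, every block $b\in\{2,\dots,B\}$, every initial state $y_0$, every first message $m_1$ and every selection rule as above, $$\mathbb E_c\Big[\mathbb P\big(\exists\,\tilde m\ne m_b:\ A_b(\tilde m)\cap B_{b-1}(\tilde m)\big)\Big]\le\eta ,$$ and also for each value $\mu\in\mathcal M$ of the previous message $$\mathbb E_c\Big[\mathbb P\big(m_{b-1}=\mu,\ \exists\,\tilde m\ne m_b:\ A_b(\tilde m)\cap B_{b-1}(\tilde m)\big)\Big]\le\eta\;\mathbb E_c\big[\mathbb P(m_{b-1}=\mu)\big],$$ i.e. the first bound also holds conditionally on $m_{b-1}=\mu$.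 In particular (take $\eta=\varepsilon$) these probabilities are at most $\varepsilon$ for all large $n$. -/

import Mathlib

open scoped BigOperators

noncomputable section

namespace BlockMarkov

/-! ### Empirical distributions, typicality, conditional mutual information -/

open Classical in
/-- Empirical distribution of a sequence `z` of length `n` over a finite alphabet. -/
def empirical {A : Type*} {n : ℕ} (z : Fin n → A) (a : A) : ℝ :=
  ((Finset.univ.filter fun t => z t = a).card : ℝ) / (n : ℝ)

/-- Strong typicality in `ℓ¹` distance: the empirical distribution of `z` is within `ε` of `P`. -/
def Typical {A : Type*} [Fintype A] {n : ℕ} (ε : ℝ) (P : A → ℝ) (z : Fin n → A) : Prop :=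
  ∑ a, |empirical z a - P a| ≤ ε

/-- `I(X;Y|Z)` in bits, for a joint mass function `q` of `(Z, X, Y)`.
Terms with `q (z, x, y) = 0` vanish. -/
def condMutualInfo {C A D : Type*} [Fintype C] [Fintype A] [Fintype D]
    (q : C × A × D → ℝ) : ℝ :=
  ∑ z, ∑ x, ∑ y, q (z, x, y) *
    Real.logb 2
      ((q (z, x, y) * ∑ x', ∑ y', q (z, x', y')) /
        ((∑ y', q (z, x, y')) * ∑ x', q (z, x', y)))

/-! ### Source, channel, and target distribution -/

/-- The single-letter data: the source law `P_U`, the input law `P_X`, the test channel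
`P_{W|U,X}`, the Markov channel `𝒲(y | x, y')`, and an equilibrium law `π` of the output chain
driven by i.i.d. inputs of law `P_X`. -/
structure Model (U X Y W : Type*) [Fintype U] [Fintype X] [Fintype Y] [Fintype W] where
  /-- `P_U(u)` -/
  PU : U → ℝ
  /-- `P_X(x)` -/
  PX : X → ℝ
  /-- `PWUX u x w` is `P_{W|U,X}(w | u, x)` -/
  PWUX : U → X → W → ℝ
  /-- `ch x y' y` is `𝒲(y | x, y')` -/
  ch : X → Y → Y → ℝ
  /-- `π(y)` -/
  equil : Y → ℝ
  PU_mem : PU ∈ stdSimplex ℝ U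
  PX_mem : PX ∈ stdSimplex ℝ X
  PWUX_mem : ∀ u x, PWUX u x ∈ stdSimplex ℝ W
  ch_mem : ∀ x y', ch x y' ∈ stdSimplex ℝ Y
  equil_mem : equil ∈ stdSimplex ℝ Y
  equil_eq : ∀ y, equil y = ∑ x, ∑ y', equil y' * PX x * ch x y' y

namespace Model

variable {U X Y W : Type*} [Fintype U] [Fintype X] [Fintype Y] [Fintype W]

/-- `P_{W|X}(w | x)`; recall that `U` and `X` are independent. -/
def PWX (S : Model U X Y W) (x : X) (w : W) : ℝ := ∑ u, S.PU u * S.PWUX u x w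

/-- `P_{U,X,W} = P_U P_X P_{W|U,X}`. -/
def lawUXW (S : Model U X Y W) : U × X × W → ℝ :=
  fun a => S.PU a.1 * S.PX a.2.1 * S.PWUX a.1 a.2.1 a.2.2

/-- `P_{Y',X,Y} = π P_X 𝒲`. -/
def lawYXY (S : Model U X Y W) : Y × X × Y → ℝ :=
  fun a => S.equil a.1 * S.PX a.2.1 * S.ch a.2.1 a.1 a.2.2

/-- `P_{W,Y',X,Y} = P_X P_{W|X} π 𝒲`, the marginal of `P_U P_X P_{W|U,X} π 𝒲`. -/
def lawWYXY (S : Model U X Y W) : W × Y × X × Y → ℝ :=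
  fun a => S.PX a.2.2.1 * S.PWX a.2.2.1 a.1 * S.equil a.2.1 * S.ch a.2.2.1 a.2.1 a.2.2.2

end Model

/-! ### The block-Markov random code -/

/-- A codebook with `K` messages and block length `n`: the sequences `x^n(m)` and
`w^n(m, m')`. -/
abbrev Codebook (X W : Type*) (n K : ℕ) : Type _ :=
  (Fin K → Fin n → X) × (Fin K → Fin K → Fin n → W)

/-- How the encoder picks one index out of the set of admissible (jointly typical) indices;
it may depend on the block and on the previous message. -/
abbrev Selection (K : ℕ) : Type := ℕ → Fin K → Finset (Fin K) → Fin K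

/-- The rule picks an admissible index whenever there is one. -/
def Selection.Valid {K : ℕ} (sel : Selection K) : Prop :=
  ∀ b m s, s.Nonempty → sel b m s ∈ s

section Code

variable {U X Y W : Type*} [Fintype U] [Fintype X] [Fintype Y] [Fintype W]
variable {n K B : ℕ}

/-- Probability of a codebook: the `x^n(m)` are i.i.d. of law `P_X^{⊗n}`, and given them the
`w^n(m, m')` are independent of law `∏ₜ P_{W|X}(· | xₜ(m))`. -/
def codebookLaw (S : Model U X Y W) (c : Codebook X W n K) : ℝ :=
  ∏ m, ((∏ t, S.PX (c.1 m t)) * ∏ m', ∏ t, S.PWX (c.1 m t) (c.2 m m' t))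

open Classical in
/-- The indices `m'` such that `(u^n, x^n(m), w^n(m, m'))` is jointly typical. -/
def admissible (S : Model U X Y W) (ε : ℝ) (c : Codebook X W n K) (m : Fin K)
    (u : Fin n → U) : Finset (Fin K) :=
  Finset.univ.filter fun m' => Typical ε S.lawUXW fun t => (u t, c.1 m t, c.2 m m' t)

/-- The message sent in block `b` (blocks are numbered `0, …, B - 1`): the first one is `m₁`;
the message of block `b + 1` is selected from the source sequence of block `b`. -/
def message (S : Model U X Y W) (ε : ℝ) (m₁ : Fin K) (sel : Selection K)
    (c : Codebook X W n K) (u : Fin B → Fin n → U) : (b : ℕ) → b < B → Fin K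
  | 0, _ => m₁
  | b + 1, h =>
    sel b (message S ε m₁ sel c u b (Nat.lt_of_succ_lt h))
      (admissible S ε c (message S ε m₁ sel c u b (Nat.lt_of_succ_lt h))
        (u ⟨b, Nat.lt_of_succ_lt h⟩))

/-- The channel state just before time `t` of block `b`: the preceding channel output, which for
the first symbol of a block is the last output of the previous block, and `y₀` at the start. -/
def prevState (y₀ : Y) (y : Fin B → Fin n → Y) (b : Fin B) (t : Fin n) : Y :=
  if 0 < t.val then y b ⟨t.val - 1, by omega⟩
  else if 0 < b.val then y ⟨b.val - 1, by omega⟩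
    ⟨n - 1, Nat.sub_lt (Nat.lt_of_le_of_lt (Nat.zero_le _) t.isLt) Nat.one_pos⟩
  else y₀

/-- For a fixed codebook, the probability of source sequences `u` and channel outputs `y` over
all `B` blocks. -/
def transmissionLaw (S : Model U X Y W) (ε : ℝ) (y₀ : Y) (m₁ : Fin K) (sel : Selection K)
    (c : Codebook X W n K) (u : Fin B → Fin n → U) (y : Fin B → Fin n → Y) : ℝ :=
  ∏ b : Fin B, ∏ t : Fin n,
    S.PU (u b t) *
      S.ch (c.1 (message S ε m₁ sel c u b.val b.isLt) t) (prevState y₀ y b t) (y b t)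

open Classical in
/-- `𝔼_c[ℙ(E)]`: the expectation over the random codebook of the probability of the event `E`,
which may depend on the codebook, the source sequences, and the channel outputs. -/
def expectedProb (S : Model U X Y W) (ε : ℝ) (y₀ : Y) (m₁ : Fin K) (sel : Selection K)
    (E : Codebook X W n K → (Fin B → Fin n → U) → (Fin B → Fin n → Y) → Prop) : ℝ :=
  ∑ c : Codebook X W n K, codebookLaw S c *
    ∑ u : Fin B → Fin n → U, ∑ y : Fin B → Fin n → Y,
      if E c u y then transmissionLaw S ε y₀ m₁ sel c u y else 0

/-- `A_b(m')`: the output of block `b` and `x^n(m')` are input-driven Markov typical. -/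
def eventA (S : Model U X Y W) (ε : ℝ) (y₀ : Y) (c : Codebook X W n K)
    (y : Fin B → Fin n → Y) (b : Fin B) (m' : Fin K) : Prop :=
  Typical ε S.lawYXY fun t => (prevState y₀ y b t, c.1 m' t, y b t)

/-- `B_b(m')`: with `m_b` the message sent in block `b`, the output of block `b`, `x^n(m_b)` and
`w^n(m_b, m')` are input-driven Markov typical. -/
def eventB (S : Model U X Y W) (ε : ℝ) (y₀ : Y) (m₁ : Fin K) (sel : Selection K)
    (c : Codebook X W n K) (u : Fin B → Fin n → U) (y : Fin B → Fin n → Y) (b : Fin B)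
    (m' : Fin K) : Prop :=
  Typical ε S.lawWYXY fun t =>
    (c.2 (message S ε m₁ sel c u b.val b.isLt) m' t, prevState y₀ y b t,
      c.1 (message S ε m₁ sel c u b.val b.isLt) t, y b t)

/-- Some index `m'` other than the message of block `b + 1` satisfies both
`A_{b+1}(m')` and `B_b(m')`. -/
def confusion (S : Model U X Y W) (ε : ℝ) (y₀ : Y) (m₁ : Fin K) (sel : Selection K)
    (b : ℕ) (hb : b + 1 < B) (c : Codebook X W n K) (u : Fin B → Fin n → U)
    (y : Fin B → Fin n → Y) : Prop :=
  ∃ m' : Fin K, m' ≠ message S ε m₁ sel c u (b + 1) hb ∧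
    eventA S ε y₀ c y ⟨b + 1, hb⟩ m' ∧
    eventB S ε y₀ m₁ sel c u y ⟨b, Nat.lt_of_succ_lt hb⟩ m'

end Code

end BlockMarkov

end

open scoped BigOperators

noncomputable section

namespace BlockMarkov

/-! ### Permutations of a sequence and typicality -/

/-! The event on the earlier block is discarded: a union bound over the wrong indices `m'`, with
only the typicality of `x^n(m')` and the later block's output, already suffices. The obstacle is
dependence: `m'` may have been sent before, and its row of `w`-words may have steered the selection,
so `x^n(m')` is not independent of the message path or of the channel state.

Exchangeability replaces independence. Permuting the positions of `x^n(m')`, of all `w^n(m', ·)`,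
and of the source blocks during which `m'` is sent preserves the joint law and every admissible set,
hence the whole message path (`message_perm`, `sourceLaw_permEquiv`). The state at the start of the
block may still depend on `x^n(m')`; summing over all initial states (`sum_channel_event_le`)
removes this at the cost of a factor `|Y|`.

What remains is counting: for fixed states and outputs, a uniformly permuted word is typical with
probability about `exp(n H(X|Y,Y')) · exp(-n H(X))`, the number of typical words times the inverse
size of a type class (`Model.exists_card_perm_typical_le`). This beats the number of messages. Since
the path is preserved, the argument works unchanged on any event about the previous message, which
gives the conditional bound. -/

theorem sum_apply_eq_sum_empirical {A : Type*} [Fintype A] {n : ℕ} (z : Fin n → A) (f : A → ℝ) :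
    ∑ t, f (z t) = n * ∑ a, empirical z a * f a := by
  classical
  rcases Nat.eq_zero_or_pos n with rfl | hn
  · simp
  have hn' : (n : ℝ) ≠ 0 := by positivity
  rw [← Finset.sum_fiberwise Finset.univ z, Finset.mul_sum]
  refine Finset.sum_congr rfl fun a _ => ?_
  rw [Finset.sum_congr rfl (g := fun _ => f a)
    (fun t ht => by rw [(Finset.mem_filter.mp ht).2])]
  rw [Finset.sum_const, nsmul_eq_mul, empirical]
  field_simp

/-- Sums of a bounded function along a typical sequence are close to the mean. -/
theorem Typical.abs_sum_sub_le {A : Type*} [Fintype A] {n : ℕ} {ε : ℝ} {P : A → ℝ}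
    {z : Fin n → A} (h : Typical ε P z) (f : A → ℝ) {M : ℝ} (hf : ∀ a, |f a| ≤ M) (hM : 0 ≤ M) :
    |∑ t, f (z t) - n * ∑ a, P a * f a| ≤ n * (ε * M) := by
  rw [sum_apply_eq_sum_empirical, ← mul_sub, ← Finset.sum_sub_distrib, abs_mul, Nat.abs_cast]
  refine mul_le_mul_of_nonneg_left ?_ (Nat.cast_nonneg n)
  calc |∑ a, (empirical z a * f a - P a * f a)|
      ≤ ∑ a, |empirical z a * f a - P a * f a| := Finset.abs_sum_le_sum_abs _ _
    _ ≤ ∑ a, |empirical z a - P a| * M := Finset.sum_le_sum fun a _ => by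
        rw [← sub_mul, abs_mul]
        exact mul_le_mul_of_nonneg_left (hf a) (abs_nonneg _)
    _ ≤ ε * M := by
        rw [← Finset.sum_mul]
        exact mul_le_mul_of_nonneg_right h hM

/-! ### Factorial estimates, type classes and entropy -/

theorem factorial_le_mul_exp {k n : ℕ} (hn : 0 < n) (hk : k ≤ n) :
    (k.factorial : ℝ) ≤ Real.exp 1 * n * Real.exp (k * Real.log k - k) := by
  have key : ∀ j : ℕ, ((j + 1).factorial : ℝ) ≤
      Real.exp 1 * (j + 1 : ℕ) * Real.exp ((j + 1 : ℕ) * Real.log (j + 1 : ℕ) - (j + 1 : ℕ)) := by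
    intro j
    induction j with
    | zero => simp [← Real.exp_add]
    | succ j ih =>
      have hj : (0 : ℝ) < (j + 1 : ℕ) := by positivity
      have hj2 : (0 : ℝ) < (j + 1 + 1 : ℕ) := by positivity
      rw [Nat.factorial_succ, Nat.cast_mul]
      refine (mul_le_mul_of_nonneg_left ih hj2.le).trans ?_
      rw [mul_comm, mul_assoc, mul_assoc, mul_assoc]
      refine mul_le_mul_of_nonneg_left ?_ (Real.exp_pos 1).le
      -- The induction step reduces to `(j+2) log((j+2)/(j+1)) ≥ 1`, which is `log x ≥ 1 - 1/x`.
      have hlog : 1 ≤ ((j + 1 + 1 : ℕ) : ℝ) *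
          (Real.log (j + 1 + 1 : ℕ) - Real.log (j + 1 : ℕ)) := by
        have := Real.one_sub_inv_le_log_of_pos (div_pos hj2 hj)
        rw [Real.log_div hj2.ne' hj.ne', inv_div] at this
        have h2 : ((j + 1 + 1 : ℕ) : ℝ) * (1 - (j + 1 : ℕ) / (j + 1 + 1 : ℕ)) = 1 := by
          field_simp
          push_cast
          ring
        calc (1 : ℝ) = _ := h2.symm
          _ ≤ _ := mul_le_mul_of_nonneg_left this hj2.le
      calc ((j + 1 : ℕ) : ℝ) * (Real.exp ((j + 1 : ℕ) * Real.log (j + 1 : ℕ) - (j + 1 : ℕ)) *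
            (j + 1 + 1 : ℕ))
          = (j + 1 + 1 : ℕ) * Real.exp (Real.log (j + 1 : ℕ) +
              ((j + 1 : ℕ) * Real.log (j + 1 : ℕ) - (j + 1 : ℕ))) := by
            rw [Real.exp_add, Real.exp_log hj]
            ring
        _ ≤ (j + 1 + 1 : ℕ) * Real.exp ((j + 1 + 1 : ℕ) * Real.log (j + 1 + 1 : ℕ)
              - (j + 1 + 1 : ℕ)) := by
            refine mul_le_mul_of_nonneg_left (Real.exp_le_exp.mpr ?_) hj2.le
            push_cast at hlog ⊢
            linarith
  rcases k with _ | j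
  · have h1 : (1 : ℝ) ≤ n := by exact_mod_cast hn
    have h2 : (1 : ℝ) ≤ Real.exp 1 := Real.one_le_exp zero_le_one
    simpa using one_le_mul_of_one_le_of_one_le h2 h1
  · refine (key j).trans ?_
    gcongr

/-- `n^n / n!` is a single term of the series for `e^n`. -/
theorem exp_le_factorial (n : ℕ) : Real.exp (n * Real.log n - n) ≤ n.factorial := by
  rcases Nat.eq_zero_or_pos n with rfl | hn
  · simp
  have hn' : (0 : ℝ) < n := by exact_mod_cast hn
  have h := Real.pow_div_factorial_le_exp (n : ℝ) hn'.le n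
  rw [Real.exp_sub, div_le_iff₀ (Real.exp_pos _), mul_comm (n : ℝ), Real.exp_mul,
    Real.exp_log hn', Real.rpow_natCast]
  rwa [div_le_iff₀ (by positivity), mul_comm] at h

-- If nonempty, the set of permutations carrying `x` to `x'` is a coset of the stabilizer of `x`,
-- whose order is the product of factorials.
open Classical in
theorem card_perm_comp_eq_le {A : Type*} [Fintype A] {n : ℕ} (x x' : Fin n → A) :
    (Finset.univ.filter fun σ : Equiv.Perm (Fin n) => x ∘ σ = x').card ≤
      ∏ a, (Finset.univ.filter fun t => x t = a).card.factorial := by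
  rcases (Finset.univ.filter fun σ : Equiv.Perm (Fin n) => x ∘ σ = x').eq_empty_or_nonempty
    with h | ⟨τ, hτ⟩
  · simp [h]
  have hτ' : x ∘ τ = x' := (Finset.mem_filter.mp hτ).2
  have hst := DomMulAct.stabilizer_card x
  simp only [Fintype.card_subtype] at hst
  rw [← hst]
  refine Finset.card_le_card_of_injOn (fun σ => σ * τ⁻¹) ?_ (fun a _ b _ h => by simpa using h)
  intro σ hσ
  have hσ' : x ∘ σ = x' := by simpa using hσ
  simp only [Finset.coe_filter, Finset.mem_univ, true_and, Set.mem_ofPred_eq]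
  funext t
  have := congrFun (hσ'.trans hτ'.symm) (τ⁻¹ t)
  simpa using this

/-- The entropy of the empirical distribution controls the size of a type class. -/
theorem prod_factorial_le {A : Type*} [Fintype A] {n : ℕ} (hn : 0 < n) (x : Fin n → A) :
    ∏ a, ((open Classical in (Finset.univ.filter fun t => x t = a).card).factorial : ℝ) ≤
      (Real.exp 1 * n) ^ Fintype.card A *
        Real.exp (-(n * ∑ a, Real.negMulLog (empirical x a))) * n.factorial := by
  classical
  have hn' : (0 : ℝ) < n := by exact_mod_cast hn
  set k : A → ℕ := fun a => (Finset.univ.filter fun t => x t = a).card with hk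
  have hsum : ∑ a, k a = n := by
    have := Finset.card_eq_sum_card_fiberwise (f := x) (s := Finset.univ) (t := Finset.univ)
      (fun _ _ => Finset.mem_univ _)
    simpa [hk] using this.symm
  have hkn : ∀ a, k a ≤ n := fun a => by simpa [hk] using Finset.card_filter_le Finset.univ (fun t => x t = a)
  have hsum' : ∑ a, (k a : ℝ) = n := by exact_mod_cast hsum
  have hterm : ∀ a, (n : ℝ) * Real.negMulLog (empirical x a) =
      k a * Real.log n - k a * Real.log (k a) := by
    intro a
    have he : empirical x a = k a / n := by simp only [empirical, hk]
    rw [he, Real.negMulLog]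
    rcases Nat.eq_zero_or_pos (k a) with h0 | h0
    · simp [h0]
    · have : (0 : ℝ) < k a := by exact_mod_cast h0
      rw [Real.log_div this.ne' hn'.ne']
      field_simp
      ring
  have hup : ∏ a, ((k a).factorial : ℝ) ≤ (Real.exp 1 * n) ^ Fintype.card A *
      Real.exp (∑ a, (k a * Real.log (k a) - k a)) := by
    rw [Real.exp_sum]
    calc ∏ a, ((k a).factorial : ℝ)
        ≤ ∏ a, (Real.exp 1 * n * Real.exp (k a * Real.log (k a) - k a)) :=
          Finset.prod_le_prod (fun _ _ => by positivity)
            fun a _ => factorial_le_mul_exp hn (hkn a)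
      _ = _ := by rw [Finset.prod_mul_distrib, Finset.prod_const, Finset.card_univ]
  refine hup.trans ?_
  rw [mul_assoc]
  refine mul_le_mul_of_nonneg_left ?_ (by positivity)
  refine le_trans (le_of_eq ?_)
    (mul_le_mul_of_nonneg_left (exp_le_factorial n) (Real.exp_pos _).le)
  rw [← Real.exp_add, Finset.mul_sum, Finset.sum_congr rfl fun a _ => hterm a,
    Finset.sum_sub_distrib, Finset.sum_sub_distrib, ← Finset.sum_mul, hsum']
  congr 1
  ring

open Classical in
/-- Few sequences have a large conditional likelihood. -/
theorem card_le_exp {V A : Type*} [Fintype A] {n : ℕ} (v : Fin n → V) (r : V → A → ℝ)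
    (hr : ∀ v a, 0 < r v a) (hr1 : ∀ v, ∑ a, r v a ≤ 1) (c : ℝ) (s : Finset (Fin n → A))
    (hs : ∀ x ∈ s, -c ≤ ∑ t, Real.log (r (v t) (x t))) : (s.card : ℝ) ≤ Real.exp c := by
  -- The likelihoods of all words sum to at most one, while each word of `s` contributes at least
  -- `exp(-c)`.
  have h1 : ∑ x ∈ s, ∏ t, r (v t) (x t) ≤ 1 := by
    calc ∑ x ∈ s, ∏ t, r (v t) (x t) ≤ ∑ x : Fin n → A, ∏ t, r (v t) (x t) :=
          Finset.sum_le_sum_of_subset_of_nonneg (Finset.subset_univ s)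
            fun x _ _ => Finset.prod_nonneg fun t _ => (hr _ _).le
      _ = ∏ t, ∑ a, r (v t) a := by rw [Finset.prod_univ_sum, Fintype.piFinset_univ]
      _ ≤ 1 := Finset.prod_le_one (fun t _ => Finset.sum_nonneg fun a _ => (hr _ _).le)
          fun t _ => hr1 _
  have h2 : ∑ x ∈ s, Real.exp (-c) ≤ 1 := by
    refine (Finset.sum_le_sum fun x hx => ?_).trans h1
    rw [← Real.exp_log (Finset.prod_pos fun t _ => hr (v t) (x t)),
      Real.log_prod fun t _ => (hr _ _).ne']
    exact Real.exp_le_exp.mpr (hs x hx)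
  rw [Finset.sum_const, nsmul_eq_mul, Real.exp_neg] at h2
  have := Real.exp_pos c
  rwa [← div_eq_mul_inv, div_le_one this] at h2

/-- Continuity of entropy; it converts closeness of types into a lower bound on the size of the type
class. -/
theorem exists_entropy_lower {A : Type*} [Fintype A] (P : A → ℝ) {d : ℝ} (hd : 0 < d) :
    ∃ ε₁ : ℝ, 0 < ε₁ ∧ ∀ p : A → ℝ, (∀ a, |p a - P a| < ε₁) →
      ∑ a, Real.negMulLog (P a) - d ≤ ∑ a, Real.negMulLog (p a) := by
  have hc : Continuous fun p : A → ℝ => ∑ a, Real.negMulLog (p a) :=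
    continuous_finsetSum _ fun a _ => Real.continuous_negMulLog.comp (continuous_apply a)
  obtain ⟨ε₁, h1, h2⟩ := Metric.continuousAt_iff.mp (hc.continuousAt (x := P)) d hd
  refine ⟨ε₁, h1, fun p hp => ?_⟩
  have := h2 ((dist_pi_lt_iff h1).mpr fun a => by rw [Real.dist_eq]; exact hp a)
  rw [Real.dist_eq] at this
  linarith [(abs_lt.mp this).1]

/-! ### Mutual information and the permutation count -/

section SingleLetter

variable {U X Y W : Type*} [Fintype U] [Fintype X] [Fintype Y] [Fintype W]

namespace Model

theorem lawYXY_nonneg (S : Model U X Y W) (a : Y × X × Y) : 0 ≤ S.lawYXY a :=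
  mul_nonneg (mul_nonneg (S.equil_mem.1 _) (S.PX_mem.1 _)) ((S.ch_mem _ _).1 _)

theorem sum_lawYXY_output (S : Model U X Y W) (z : Y) (x : X) :
    ∑ y, S.lawYXY (z, x, y) = S.equil z * S.PX x := by
  simp only [lawYXY]
  rw [← Finset.mul_sum, (S.ch_mem _ _).2, mul_one]

theorem sum_lawYXY_input_output (S : Model U X Y W) (z : Y) :
    ∑ x, ∑ y, S.lawYXY (z, x, y) = S.equil z := by
  simp only [sum_lawYXY_output]
  rw [← Finset.mul_sum, S.PX_mem.2, mul_one]

/-- Integrating a function of the input against `P_{Y',X,Y}`. -/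
theorem sum_lawYXY_mul_input (S : Model U X Y W) (f : X → ℝ) :
    ∑ z, ∑ x, ∑ y, S.lawYXY (z, x, y) * f x = ∑ x, S.PX x * f x := by
  simp only [← Finset.sum_mul, sum_lawYXY_output, mul_assoc, ← Finset.mul_sum]
  rw [S.equil_mem.2, one_mul]

/-- `I(X;Y|Y') = H(X) - H(X|Y,Y')`, in nats, since `X` and `Y'` are independent. -/
theorem condMutualInfo_mul_log (S : Model U X Y W) :
    condMutualInfo S.lawYXY * Real.log 2 =
      ∑ x, Real.negMulLog (S.PX x) + ∑ z, ∑ x, ∑ y, S.lawYXY (z, x, y) *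
        Real.log (S.lawYXY (z, x, y) / ∑ x', S.lawYXY (z, x', y)) := by
  have hH : ∑ x, Real.negMulLog (S.PX x) =
      ∑ z, ∑ x, ∑ y, S.lawYXY (z, x, y) * (-Real.log (S.PX x)) := by
    rw [S.sum_lawYXY_mul_input fun x => -Real.log (S.PX x)]
    exact Finset.sum_congr rfl fun x _ => by rw [Real.negMulLog]; ring
  rw [hH, condMutualInfo]
  simp only [sum_lawYXY_input_output]
  simp only [sum_lawYXY_output, ← Finset.sum_add_distrib, Finset.sum_mul]
  refine Finset.sum_congr rfl fun z _ => Finset.sum_congr rfl fun x _ =>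
    Finset.sum_congr rfl fun y _ => ?_
  rcases (S.lawYXY_nonneg (z, x, y)).eq_or_lt with h0 | h0
  · simp [← h0]
  have hz : S.equil z ≠ 0 := fun h => by simp [lawYXY, h] at h0
  have hx : S.PX x ≠ 0 := fun h => by simp [lawYXY, h] at h0
  have hQ : ∑ x', S.lawYXY (z, x', y) ≠ 0 :=
    (h0.trans_le (Finset.single_le_sum (f := fun x' => S.lawYXY (z, x', y))
      (fun x' _ => S.lawYXY_nonneg _) (Finset.mem_univ x))).ne'
  have hlog2 : Real.log 2 ≠ 0 := (Real.log_pos one_lt_two).ne'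
  rw [Real.logb, mul_assoc, div_mul_cancel₀ _ hlog2, ← mul_add]
  congr 1
  have : S.lawYXY (z, x, y) * S.equil z / (S.equil z * S.PX x * ∑ x', S.lawYXY (z, x', y)) =
      (S.lawYXY (z, x, y) / ∑ x', S.lawYXY (z, x', y)) / S.PX x := by
    field_simp
  rw [this, Real.log_div (div_ne_zero h0.ne' hQ) hx]
  ring

/-- A strictly positive conditional law of `X` given `(Y', Y)` which is nearly optimal for the
conditional cross-entropy. -/
theorem exists_pos_conditional (S : Model U X Y W) {d : ℝ} (hd : 0 < d) :
    ∃ r : Y × Y → X → ℝ, (∀ v a, 0 < r v a) ∧ (∀ v, ∑ a, r v a ≤ 1) ∧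
      ∑ z, ∑ x, ∑ y, S.lawYXY (z, x, y) *
          Real.log (S.lawYXY (z, x, y) / ∑ x', S.lawYXY (z, x', y)) - d ≤
        ∑ z, ∑ x, ∑ y, S.lawYXY (z, x, y) * Real.log (r (z, y) x) := by
  have hX : Nonempty X := by
    by_contra h
    rw [not_nonempty_iff] at h
    simpa using S.PX_mem.2
  have hc : (0 : ℝ) < Fintype.card X := by exact_mod_cast Fintype.card_pos
  have he : Real.exp (-d) < 1 := by simpa using hd
  have hQ : ∀ z y, 0 ≤ ∑ x', S.lawYXY (z, x', y) :=
    fun z y => Finset.sum_nonneg fun _ _ => S.lawYXY_nonneg _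
  have hq : ∀ z x y, 0 ≤ S.lawYXY (z, x, y) / ∑ x', S.lawYXY (z, x', y) :=
    fun z x y => div_nonneg (S.lawYXY_nonneg _) (hQ z y)
  -- Mixing with the uniform law keeps every logarithm finite, and weight `exp(-d)` on the true
  -- conditional costs at most `d` nats. Where `(Y', Y)` has mass zero the quotient is `0`, so the
  -- total is only `≤ 1`.
  refine ⟨fun v a => Real.exp (-d) * (S.lawYXY (v.1, a, v.2) / ∑ x', S.lawYXY (v.1, x', v.2)) +
    (1 - Real.exp (-d)) / Fintype.card X, fun v a => ?_, fun v => ?_, ?_⟩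
  · exact add_pos_of_nonneg_of_pos (mul_nonneg (Real.exp_pos _).le (hq _ _ _))
      (div_pos (by linarith) hc)
  · rw [Finset.sum_add_distrib, ← Finset.mul_sum, ← Finset.sum_div, Finset.sum_const,
      Finset.card_univ, nsmul_eq_mul, mul_div_cancel₀ _ hc.ne']
    have := mul_le_mul_of_nonneg_left (div_self_le_one (∑ x', S.lawYXY (v.1, x', v.2)))
      (Real.exp_pos (-d)).le
    linarith
  · have hd1 : d = ∑ z, ∑ x, ∑ y, S.lawYXY (z, x, y) * d := by
      rw [S.sum_lawYXY_mul_input fun _ => d, ← Finset.sum_mul, S.PX_mem.2, one_mul]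
    nth_rewrite 1 [hd1]
    simp only [← Finset.sum_sub_distrib]
    refine Finset.sum_le_sum fun z _ => Finset.sum_le_sum fun x _ =>
      Finset.sum_le_sum fun y _ => ?_
    rcases (S.lawYXY_nonneg (z, x, y)).eq_or_lt with h0 | h0
    · simp [← h0]
    rw [← mul_sub]
    refine mul_le_mul_of_nonneg_left ?_ h0.le
    have hQ' : 0 < ∑ x', S.lawYXY (z, x', y) :=
      h0.trans_le (Finset.single_le_sum (f := fun x' => S.lawYXY (z, x', y))
        (fun x' _ => S.lawYXY_nonneg _) (Finset.mem_univ x))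
    have hpos := div_pos h0 hQ'
    calc Real.log (S.lawYXY (z, x, y) / ∑ x', S.lawYXY (z, x', y)) - d
        = Real.log (Real.exp (-d) * (S.lawYXY (z, x, y) / ∑ x', S.lawYXY (z, x', y))) := by
          rw [Real.log_mul (Real.exp_pos _).ne' hpos.ne', Real.log_exp]
          ring
      _ ≤ _ := Real.log_le_log (mul_pos (Real.exp_pos _) hpos)
          (le_add_of_nonneg_right (div_nonneg (by linarith) hc.le))

open Classical in
/-- A randomly permuted word is jointly typical with a fixed state and output sequence with
probability about `2 ^ (-n I(X;Y|Y'))`. -/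
theorem exists_card_perm_typical_le (S : Model U X Y W) {d : ℝ} (hd : 0 < d) :
    ∃ ε₀ : ℝ, 0 < ε₀ ∧ ∀ ε : ℝ, 0 < ε → ε < ε₀ → ∀ n : ℕ, 0 < n →
      ∀ (v z : Fin n → Y) (x : Fin n → X),
        ((Finset.univ.filter fun σ : Equiv.Perm (Fin n) =>
          Typical ε S.lawYXY fun t => (v t, x (σ t), z t)).card : ℝ) ≤
        (Real.exp 1 * n) ^ Fintype.card X *
          Real.exp (-(n * (condMutualInfo S.lawYXY * Real.log 2 - 3 * d))) * n.factorial := by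
  obtain ⟨ε₁, hε₁, hent⟩ := exists_entropy_lower S.PX hd
  obtain ⟨r, hr, hr1, hrq⟩ := S.exists_pos_conditional hd
  set M : ℝ := ∑ a : Y × X × Y, |Real.log (r (a.1, a.2.2) a.2.1)| with hM
  have hM0 : 0 ≤ M := Finset.sum_nonneg fun _ _ => abs_nonneg _
  -- `ε₁` serves the continuity of entropy; `d / (M + 1)` keeps the log-likelihood fluctuation `ε *
  -- M` below `d`.
  refine ⟨min ε₁ (d / (M + 1)), lt_min hε₁ (by positivity), fun ε hε hεlt n hn v z x => ?_⟩
  have hεM : ε * M ≤ d := by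
    have := (lt_min_iff.mp hεlt).2
    rw [lt_div_iff₀ (by positivity)] at this
    nlinarith
  have hn' : (0 : ℝ) < n := by exact_mod_cast hn
  set F := Finset.univ.filter fun σ : Equiv.Perm (Fin n) =>
    Typical ε S.lawYXY fun t => (v t, x (σ t), z t) with hF
  rcases F.eq_empty_or_nonempty with h0 | ⟨τ, hτ⟩
  · rw [h0, Finset.card_empty, Nat.cast_zero]
    positivity
  set L : ℝ := ∑ z, ∑ x, ∑ y, S.lawYXY (z, x, y) * Real.log (r (z, y) x) with hL
  set T := Finset.univ.filter fun x' : Fin n → X =>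
    Typical ε S.lawYXY fun t => (v t, x' t, z t) with hT
  have hTcard : (T.card : ℝ) ≤ Real.exp (n * (d - L)) := by
    refine card_le_exp (fun t => (v t, z t)) r hr hr1 _ T fun x' hx' => ?_
    have h1 := (Finset.mem_filter.mp hx').2.abs_sum_sub_le
      (fun a => Real.log (r (a.1, a.2.2) a.2.1)) (M := M)
      (fun a => Finset.single_le_sum
        (f := fun a : Y × X × Y => |Real.log (r (a.1, a.2.2) a.2.1)|)
        (fun _ _ => abs_nonneg _) (Finset.mem_univ a)) hM0
    simp only [Fintype.sum_prod_type] at h1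
    rw [← hL] at h1
    have h2 := (abs_le.mp h1).1
    have h3 := mul_le_mul_of_nonneg_left hεM hn'.le
    linarith
  -- Fibre the permutations over the word `x ∘ σ` that they produce.
  have hFT : F.card ≤ T.card * ∏ a, (Finset.univ.filter fun t => x t = a).card.factorial := by
    have := Finset.card_le_mul_card_image_of_maps_to (f := fun σ : Equiv.Perm (Fin n) => x ∘ σ)
      (s := F) (t := T) (fun σ hσ => by simpa [hF, hT] using hσ)
      (∏ a, (Finset.univ.filter fun t => x t = a).card.factorial) (fun x' _ =>
        (Finset.card_le_card (Finset.filter_subset_filter _ (Finset.subset_univ F))).trans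
          (card_perm_comp_eq_le x x'))
    rwa [mul_comm] at this
  -- One typical permutation `τ` is enough: `x ∘ τ` has the type of `x`, so that type is close to
  -- `P_X`.
  have hemp : ∑ a, Real.negMulLog (S.PX a) - d ≤ ∑ a, Real.negMulLog (empirical x a) := by
    refine hent _ fun a => lt_of_le_of_lt ?_ (lt_min_iff.mp hεlt).1
    have h1 := (Finset.mem_filter.mp hτ).2.abs_sum_sub_le
      (fun b => if b.2.1 = a then (1 : ℝ) else 0) (M := 1)
      (fun b => by split_ifs <;> simp) zero_le_one
    simp only [Fintype.sum_prod_type] at h1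
    rw [S.sum_lawYXY_mul_input fun b => if b = a then (1 : ℝ) else 0] at h1
    rw [Equiv.sum_comp τ fun t => if x t = a then (1 : ℝ) else 0,
      sum_apply_eq_sum_empirical x fun b => if b = a then (1 : ℝ) else 0] at h1
    simp only [mul_ite, mul_one, mul_zero, Finset.sum_ite_eq', Finset.mem_univ, if_true] at h1
    rw [← mul_sub, abs_mul, Nat.abs_cast] at h1
    exact le_of_mul_le_mul_left h1 hn'
  have hfac := prod_factorial_le hn x
  calc (F.card : ℝ)
      ≤ T.card * ∏ a, ((Finset.univ.filter fun t => x t = a).card.factorial : ℝ) := by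
        exact_mod_cast hFT
    _ ≤ Real.exp (n * (d - L)) * ((Real.exp 1 * n) ^ Fintype.card X *
          Real.exp (-(n * ∑ a, Real.negMulLog (empirical x a))) * n.factorial) := by
        refine mul_le_mul hTcard ?_ (by positivity) (Real.exp_pos _).le
        convert hfac
    _ = (Real.exp 1 * n) ^ Fintype.card X *
          Real.exp (n * (d - L - ∑ a, Real.negMulLog (empirical x a))) * n.factorial := by
        rw [mul_sub (n : ℝ) (d - L), sub_eq_add_neg (n * (d - L)), Real.exp_add]
        ring
    _ ≤ _ := by
        gcongr
        rw [← mul_neg]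
        refine mul_le_mul_of_nonneg_left ?_ hn'.le
        -- The three losses of `d` come from the fluctuation, the mixing with the uniform law, and
        -- the continuity of entropy.
        rw [S.condMutualInfo_mul_log]
        linarith

end Model

end SingleLetter

/-! ### Sums of products of causal kernels -/

/-- By causality the last coordinate enters only the last factor, so it can be summed out first. In
the induction `z₀` is a placeholder for that coordinate. -/
theorem sum_prod_causal_le {Z : Type*} [Fintype Z] {N : ℕ} (f : Fin N → (Fin N → Z) → ℝ)
    (C : Fin N → ℝ) (hf : ∀ b y, 0 ≤ f b y)
    (hcausal : ∀ b y y', (∀ i ≤ b, y i = y' i) → f b y = f b y')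
    (hsum : ∀ b y, ∑ z, f b (Function.update y b z) ≤ C b) (hC : ∀ b, 0 ≤ C b) :
    ∑ y, ∏ b, f b y ≤ ∏ b, C b := by
  induction N with
  | zero => simp
  | succ N ih =>
    rcases isEmpty_or_nonempty Z with hZ | ⟨⟨z₀⟩⟩
    · have : IsEmpty (Fin (N + 1) → Z) := ⟨fun y => hZ.false (y 0)⟩
      simpa using Finset.prod_nonneg fun b _ => hC b
    have hlast : ∀ (y : Fin N → Z) (z : Z) (b : Fin N),
        f b.castSucc (Fin.snoc y z) = f b.castSucc (Fin.snoc y z₀) := fun y z b =>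
      hcausal _ _ _ fun i hi => by
        obtain ⟨j, rfl⟩ : ∃ j : Fin N, j.castSucc = i :=
          Fin.exists_castSucc_eq.mpr (hi.trans_lt b.castSucc_lt_last).ne
        simp
    rw [← (Fin.snocEquiv fun _ : Fin (N + 1) => Z).sum_comp, Fintype.sum_prod_type_right]
    have hstep : ∀ y : Fin N → Z,
        ∑ z, ∏ b, f b (Fin.snocEquiv (fun _ : Fin (N + 1) => Z) (z, y)) ≤
          (∏ b : Fin N, f b.castSucc (Fin.snoc y z₀)) * C (Fin.last N) := by
      intro y
      have h1 := hsum (Fin.last N) (Fin.snoc y z₀)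
      simp only [Fin.update_snoc_last] at h1
      simp only [Fin.snocEquiv, Equiv.coe_fn_mk, Fin.prod_univ_castSucc, hlast]
      rw [← Finset.mul_sum]
      exact mul_le_mul_of_nonneg_left h1 (Finset.prod_nonneg fun b _ => hf _ _)
    refine (Finset.sum_le_sum fun y _ => hstep y).trans ?_
    rw [← Finset.sum_mul, Fin.prod_univ_castSucc]
    refine mul_le_mul_of_nonneg_right ?_ (hC _)
    refine ih (fun b y => f b.castSucc (Fin.snoc y z₀)) (fun b => C b.castSucc)
      (fun b y => hf _ _) (fun b y y' h => ?_) (fun b y => ?_) fun b => hC _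
    · refine hcausal _ _ _ fun i hi => ?_
      obtain ⟨j, rfl⟩ : ∃ j : Fin N, j.castSucc = i :=
        Fin.exists_castSucc_eq.mpr (hi.trans_lt b.castSucc_lt_last).ne
      simpa using h j (by simpa using hi)
    · simpa [Fin.snoc_update] using hsum b.castSucc (Fin.snoc y z₀)

theorem sum_prod_causal_eq_one {Z : Type*} [Fintype Z] {N : ℕ} (f : Fin N → (Fin N → Z) → ℝ)
    (hcausal : ∀ b y y', (∀ i ≤ b, y i = y' i) → f b y = f b y')
    (hsum : ∀ b y, ∑ z, f b (Function.update y b z) = 1) (hZ : Nonempty Z) :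
    ∑ y, ∏ b, f b y = 1 := by
  obtain ⟨z₀⟩ := hZ
  induction N with
  | zero => simp
  | succ N ih =>
    have hlast : ∀ (y : Fin N → Z) (z : Z) (b : Fin N),
        f b.castSucc (Fin.snoc y z) = f b.castSucc (Fin.snoc y z₀) := fun y z b =>
      hcausal _ _ _ fun i hi => by
        obtain ⟨j, rfl⟩ : ∃ j : Fin N, j.castSucc = i :=
          Fin.exists_castSucc_eq.mpr (hi.trans_lt b.castSucc_lt_last).ne
        simp
    rw [← (Fin.snocEquiv fun _ : Fin (N + 1) => Z).sum_comp, Fintype.sum_prod_type_right]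
    have hstep : ∀ y : Fin N → Z,
        ∑ z, ∏ b, f b (Fin.snocEquiv (fun _ : Fin (N + 1) => Z) (z, y)) =
          ∏ b : Fin N, f b.castSucc (Fin.snoc y z₀) := by
      intro y
      have h1 := hsum (Fin.last N) (Fin.snoc y z₀)
      simp only [Fin.update_snoc_last] at h1
      simp only [Fin.snocEquiv, Equiv.coe_fn_mk, Fin.prod_univ_castSucc, hlast]
      rw [← Finset.mul_sum, h1, mul_one]
    rw [Finset.sum_congr rfl fun y _ => hstep y]
    refine ih (fun b y => f b.castSucc (Fin.snoc y z₀)) (fun b y y' h => ?_) (fun b y => ?_)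
    · refine hcausal _ _ _ fun i hi => ?_
      obtain ⟨j, rfl⟩ : ∃ j : Fin N, j.castSucc = i :=
        Fin.exists_castSucc_eq.mpr (hi.trans_lt b.castSucc_lt_last).ne
      simpa using h j (by simpa using hi)
    · simpa [Fin.snoc_update] using hsum b.castSucc (Fin.snoc y z₀)

/-! ### Block channel laws and elimination of the initial state -/

section Channel

variable {U X Y W : Type*} [Fintype U] [Fintype X] [Fintype Y] [Fintype W]
variable {n K B : ℕ}

/-- The channel state inside a block with outputs `z` that starts in the state `s`. -/
def stateFrom (s : Y) (z : Fin n → Y) (t : Fin n) : Y :=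
  if 0 < t.val then z ⟨t.val - 1, by omega⟩ else s

/-- The probability of the outputs `z` of a block with input word `x` and initial state `s`. -/
def blockKernel (S : Model U X Y W) (x : Fin n → X) (s : Y) (z : Fin n → Y) : ℝ :=
  ∏ t, S.ch (x t) (stateFrom s z t) (z t)

theorem blockKernel_nonneg (S : Model U X Y W) (x : Fin n → X) (s : Y) (z : Fin n → Y) :
    0 ≤ blockKernel S x s z :=
  Finset.prod_nonneg fun _ _ => (S.ch_mem _ _).1 _

theorem sum_blockKernel (S : Model U X Y W) (x : Fin n → X) (s : Y) :
    ∑ z, blockKernel S x s z = 1 := by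
  refine sum_prod_causal_eq_one (fun t z => S.ch (x t) (stateFrom s z t) (z t))
    (fun t z z' h => ?_) (fun t z => ?_) ⟨s⟩
  · have : stateFrom s z t = stateFrom s z' t := by
      simp only [stateFrom]
      split_ifs
      · exact h _ (Fin.mk_le_of_le_val (by omega))
      · rfl
    simp only [this, h t le_rfl]
  · have : ∀ a, stateFrom s (Function.update z t a) t = stateFrom s z t := fun a => by
      simp only [stateFrom]
      split_ifs with h0
      · exact Function.update_of_ne (Fin.ne_of_val_ne (by simp; omega)) _ _
      · rfl
    simp only [this, Function.update_self]
    exact (S.ch_mem _ _).2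

/-- The past acts on a block only through its initial state, which rewriting the block itself does
not alter. -/
theorem prevState_update {Y : Type*} (y₀ : Y) (hn : 0 < n) (y : Fin B → Fin n → Y) (b : Fin B)
    (z : Fin n → Y) :
    prevState y₀ (Function.update y b z) b = stateFrom (prevState y₀ y b ⟨0, hn⟩) z := by
  funext t
  simp only [prevState, stateFrom, Function.update_self, lt_self_iff_false, if_false]
  split_ifs
  · rfl
  · rw [Function.update_of_ne (Fin.ne_of_val_ne (by simp; omega))]
  · rfl

theorem prevState_congr {Y : Type*} (y₀ : Y) {y y' : Fin B → Fin n → Y} {b : Fin B}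
    (h : ∀ i ≤ b, y i = y' i) : prevState y₀ y b = prevState y₀ y' b := by
  funext t
  simp only [prevState]
  split_ifs
  · rw [h b le_rfl]
  · rw [h _ (Fin.mk_le_of_le_val (by omega))]
  · rfl

theorem sum_channel_eq_one (S : Model U X Y W) (y₀ : Y) (hn : 0 < n) (x : Fin B → Fin n → X) :
    ∑ y : Fin B → Fin n → Y, ∏ b, ∏ t, S.ch (x b t) (prevState y₀ y b t) (y b t) = 1 := by
  refine sum_prod_causal_eq_one (fun b y => ∏ t, S.ch (x b t) (prevState y₀ y b t) (y b t))
    (fun b y y' h => ?_) (fun b y => ?_) ⟨fun _ => y₀⟩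
  · simp only [prevState_congr y₀ h, h b le_rfl]
  · have h := sum_blockKernel S (x b) (prevState y₀ y b ⟨0, hn⟩)
    simp only [blockKernel] at h
    simpa only [prevState_update y₀ hn, Function.update_self]
      using h

open Classical in
/-- The probability that an event about the states and outputs of block `b` happens is at most
its probability summed over all initial states of that block. -/
theorem sum_channel_event_le (S : Model U X Y W) (y₀ : Y) (hn : 0 < n) (x : Fin B → Fin n → X)
    (b : Fin B) (E : (Fin n → Y) → (Fin n → Y) → Prop) :
    ∑ y : Fin B → Fin n → Y, (if E (prevState y₀ y b) (y b) then
        ∏ i, ∏ t, S.ch (x i t) (prevState y₀ y i t) (y i t) else 0) ≤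
      ∑ s, ∑ z, if E (stateFrom s z) z then blockKernel S (x b) s z else 0 := by
  set G : ℝ := ∑ s, ∑ z, if E (stateFrom s z) z then blockKernel S (x b) s z else 0 with hG
  have hterm : ∀ s z, 0 ≤ if E (stateFrom s z) z then blockKernel S (x b) s z else 0 :=
    fun s z => by
      split_ifs
      exacts [blockKernel_nonneg _ _ _ _, le_rfl]
  have hG0 : 0 ≤ G := Finset.sum_nonneg fun s _ => Finset.sum_nonneg fun z _ => hterm s z
  -- The indicator of the event is absorbed into the factor of block `b`, which stays causal. Its
  -- sum depends on the past through the initial state and is dominated by `G`.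
  have key := sum_prod_causal_le
    (fun (i : Fin B) (y : Fin B → Fin n → Y) =>
      if i = b ∧ ¬ E (prevState y₀ y i) (y i) then 0
      else ∏ t, S.ch (x i t) (prevState y₀ y i t) (y i t))
    (fun i => if i = b then G else 1) (fun i y => ?_) (fun i y y' h => ?_) (fun i y => ?_)
    (fun i => ?_)
  · rw [Finset.prod_ite_eq' Finset.univ b fun _ => G, if_pos (Finset.mem_univ b)] at key
    refine le_trans (le_of_eq (Finset.sum_congr rfl fun y _ => ?_)) key
    split_ifs with hE
    · refine Finset.prod_congr rfl fun i _ => ?_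
      rw [if_neg]
      rintro ⟨rfl, h⟩
      exact h hE
    · symm
      refine Finset.prod_eq_zero (Finset.mem_univ b) ?_
      rw [if_pos ⟨rfl, hE⟩]
  · split_ifs
    exacts [le_rfl, Finset.prod_nonneg fun _ _ => (S.ch_mem _ _).1 _]
  · simp only [prevState_congr y₀ h, h i le_rfl]
  · simp only [prevState_update y₀ hn, Function.update_self]
    by_cases hi : i = b
    · subst hi
      simp only [if_true, true_and, ite_not]
      exact Finset.single_le_sum (f := fun s => ∑ z,
        if E (stateFrom s z) z then blockKernel S (x i) s z else 0)
        (fun s _ => Finset.sum_nonneg fun z _ => hterm s z) (Finset.mem_univ _)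
    · simp only [hi, false_and, if_false]
      exact (sum_blockKernel S (x i) (prevState y₀ y i ⟨0, hn⟩)).le
  · split_ifs
    exacts [hG0, zero_le_one]

end Channel

/-! ### Exchangeability of a codebook row given the message path -/

theorem typical_comp_perm {A : Type*} [Fintype A] {n : ℕ} (ε : ℝ) (P : A → ℝ) (z : Fin n → A)
    (σ : Equiv.Perm (Fin n)) : (Typical ε P fun t => z (σ t)) ↔ Typical ε P z := by
  classical
  have : empirical (fun t => z (σ t)) = empirical z := by
    funext a
    simp only [empirical, Finset.card_filter]
    rw [Equiv.sum_comp σ fun t => if z t = a then 1 else 0]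
  rw [Typical, Typical, this]

section Symmetry

variable {U X Y W : Type*} [Fintype U] [Fintype X] [Fintype Y] [Fintype W]
variable {n K B : ℕ}

/-- Permute the positions of `x^n(m)` and of all `w^n(m, m')`. -/
def permRow (σ : Equiv.Perm (Fin n)) (m : Fin K) (c : Codebook X W n K) : Codebook X W n K :=
  (Function.update c.1 m (c.1 m ∘ σ), Function.update c.2 m fun m' => c.2 m m' ∘ σ)

/-- Permute the positions of the source blocks during which the message `m` is sent. -/
def permSource (S : Model U X Y W) (ε : ℝ) (m₁ : Fin K) (sel : Selection K)
    (σ : Equiv.Perm (Fin n)) (m : Fin K) (c : Codebook X W n K) (u : Fin B → Fin n → U) :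
    Fin B → Fin n → U :=
  fun b => if message S ε m₁ sel c u b b.isLt = m then u b ∘ σ else u b

/-- In row `m` all three words are permuted together, so joint types are unchanged; other rows,
including their words `w^n(k, m)`, are untouched. -/
theorem admissible_permRow (S : Model U X Y W) (ε : ℝ) (σ : Equiv.Perm (Fin n)) (m k : Fin K)
    (c : Codebook X W n K) (u : Fin n → U) :
    admissible S ε (permRow σ m c) k (if k = m then u ∘ σ else u) = admissible S ε c k u := by
  ext m'
  simp only [admissible, Finset.mem_filter, Finset.mem_univ, true_and]
  by_cases h : k = m
  · subst h
    simp only [permRow, Function.update_self, if_true, Function.comp_apply]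
    exact typical_comp_perm ε S.lawUXW (fun t => (u t, c.1 k t, c.2 k m' t)) σ
  · dsimp only [permRow]
    rw [Function.update_of_ne h, Function.update_of_ne h, if_neg h]

/-- Inductively, the current message agrees, hence so does the admissible set, and the selection
sees nothing else. -/
theorem message_perm (S : Model U X Y W) (ε : ℝ) (m₁ : Fin K) (sel : Selection K)
    (σ : Equiv.Perm (Fin n)) (m : Fin K) (c : Codebook X W n K) (u : Fin B → Fin n → U)
    (b : ℕ) (hb : b < B) :
    message S ε m₁ sel (permRow σ m c) (permSource S ε m₁ sel σ m c u) b hb =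
      message S ε m₁ sel c u b hb := by
  induction b with
  | zero => simp only [message]
  | succ b ih =>
    simp only [message, ih (Nat.lt_of_succ_lt hb)]
    congr 1
    exact admissible_permRow S ε σ m _ c _

theorem permRow_inv {X W : Type*} (σ : Equiv.Perm (Fin n)) (m : Fin K) (c : Codebook X W n K) :
    permRow σ⁻¹ m (permRow σ m c) = c := by
  refine Prod.ext ?_ ?_
  · simp only [permRow, Function.update_self, Function.update_idem]
    rw [Function.update_eq_iff]
    refine ⟨?_, fun _ _ => rfl⟩
    funext t
    simp
  · simp only [permRow, Function.update_self, Function.update_idem]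
    rw [Function.update_eq_iff]
    refine ⟨?_, fun _ _ => rfl⟩
    funext m' t
    simp

/-- The set of permuted blocks depends on the message path; invariance of the path ensures that the
same blocks are permuted back. -/
theorem permSource_inv (S : Model U X Y W) (ε : ℝ) (m₁ : Fin K) (sel : Selection K)
    (σ : Equiv.Perm (Fin n)) (m : Fin K) (c : Codebook X W n K) (u : Fin B → Fin n → U) :
    permSource S ε m₁ sel σ⁻¹ m (permRow σ m c) (permSource S ε m₁ sel σ m c u) = u := by
  funext b
  rw [permSource, message_perm]
  by_cases h : message S ε m₁ sel c u b b.isLt = m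
  · rw [if_pos h, permSource, if_pos h]
    funext t
    simp
  · rw [if_neg h, permSource, if_neg h]

/-- `permRow` and `permSource` together, as a bijection. -/
def permEquiv (S : Model U X Y W) (ε : ℝ) (m₁ : Fin K) (sel : Selection K)
    (σ : Equiv.Perm (Fin n)) (m : Fin K) :
    Codebook X W n K × (Fin B → Fin n → U) ≃ Codebook X W n K × (Fin B → Fin n → U) where
  toFun p := (permRow σ m p.1, permSource S ε m₁ sel σ m p.1 p.2)
  invFun p := (permRow σ⁻¹ m p.1, permSource S ε m₁ sel σ⁻¹ m p.1 p.2)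
  left_inv p := Prod.ext (permRow_inv σ m p.1) (permSource_inv S ε m₁ sel σ m p.1 p.2)
  right_inv p := by
    have h1 := permRow_inv σ⁻¹ m p.1
    have h2 := permSource_inv S ε m₁ sel σ⁻¹ m p.1 p.2
    rw [inv_inv] at h1 h2
    exact Prod.ext h1 h2

/-- Joint probability of the codebook and the source sequences. -/
def sourceLaw (S : Model U X Y W) (p : Codebook X W n K × (Fin B → Fin n → U)) : ℝ :=
  codebookLaw S p.1 * ∏ b, ∏ t, S.PU (p.2 b t)

theorem PWX_mem (S : Model U X Y W) (x : X) : S.PWX x ∈ stdSimplex ℝ W := by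
  refine ⟨fun w => Finset.sum_nonneg fun u _ => mul_nonneg (S.PU_mem.1 u) ((S.PWUX_mem u x).1 w), ?_⟩
  simp only [Model.PWX]
  rw [Finset.sum_comm]
  simp only [← Finset.mul_sum, (S.PWUX_mem _ x).2, mul_one, S.PU_mem.2]

theorem codebookLaw_nonneg (S : Model U X Y W) (c : Codebook X W n K) : 0 ≤ codebookLaw S c :=
  Finset.prod_nonneg fun _ _ => mul_nonneg (Finset.prod_nonneg fun _ _ => S.PX_mem.1 _)
    (Finset.prod_nonneg fun _ _ => Finset.prod_nonneg fun _ _ => (PWX_mem S _).1 _)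

theorem sourceLaw_nonneg (S : Model U X Y W) (p : Codebook X W n K × (Fin B → Fin n → U)) :
    0 ≤ sourceLaw S p :=
  mul_nonneg (codebookLaw_nonneg S p.1)
    (Finset.prod_nonneg fun _ _ => Finset.prod_nonneg fun _ _ => S.PU_mem.1 _)

theorem codebookLaw_permRow (S : Model U X Y W) (σ : Equiv.Perm (Fin n)) (m : Fin K)
    (c : Codebook X W n K) : codebookLaw S (permRow σ m c) = codebookLaw S c := by
  refine Finset.prod_congr rfl fun k _ => ?_
  by_cases h : k = m
  · subst h
    simp only [permRow, Function.update_self, Function.comp_apply]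
    rw [Equiv.prod_comp σ fun t => S.PX (c.1 k t)]
    congr 1
    exact Finset.prod_congr rfl fun m' _ =>
      Equiv.prod_comp σ fun t => S.PWX (c.1 k t) (c.2 k m' t)
  · simp [permRow, h]

theorem sourceLaw_permEquiv (S : Model U X Y W) (ε : ℝ) (m₁ : Fin K) (sel : Selection K)
    (σ : Equiv.Perm (Fin n)) (m : Fin K) (p : Codebook X W n K × (Fin B → Fin n → U)) :
    sourceLaw S (permEquiv S ε m₁ sel σ m p) = sourceLaw S p := by
  simp only [sourceLaw, permEquiv, Equiv.coe_fn_mk, codebookLaw_permRow]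
  congr 1
  refine Finset.prod_congr rfl fun b _ => ?_
  rw [permSource]
  split_ifs
  · exact Equiv.prod_comp σ fun t => S.PU (p.2 b t)
  · rfl

theorem sum_codebookLaw (S : Model U X Y W) : ∑ c : Codebook X W n K, codebookLaw S c = 1 := by
  have hw : ∀ x : Fin n → X, ∑ w : Fin K → Fin n → W, ∏ m', ∏ t, S.PWX (x t) (w m' t) = 1 := by
    intro x
    rw [← Fintype.prod_sum fun (_ : Fin K) (w : Fin n → W) => ∏ t, S.PWX (x t) (w t)]
    refine Finset.prod_eq_one fun _ _ => ?_
    rw [← Fintype.prod_sum fun (t : Fin n) (w : W) => S.PWX (x t) w]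
    exact Finset.prod_eq_one fun t _ => (PWX_mem S (x t)).2
  rw [Fintype.sum_prod_type]
  simp only [codebookLaw, Finset.prod_mul_distrib, ← Finset.mul_sum]
  have h2 : ∀ x : Fin K → Fin n → X, ∑ w : Fin K → Fin K → Fin n → W,
      ∏ m, ∏ m', ∏ t, S.PWX (x m t) (w m m' t) = 1 := by
    intro x
    rw [← Fintype.prod_sum fun (m : Fin K) (w : Fin K → Fin n → W) =>
      ∏ m', ∏ t, S.PWX (x m t) (w m' t)]
    exact Finset.prod_eq_one fun m _ => hw (x m)
  simp only [h2, mul_one]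
  rw [← Fintype.prod_sum fun (_ : Fin K) (x : Fin n → X) => ∏ t, S.PX (x t)]
  refine Finset.prod_eq_one fun _ _ => ?_
  rw [← Fintype.prod_sum fun (_ : Fin n) (x : X) => S.PX x]
  exact Finset.prod_eq_one fun _ _ => S.PX_mem.2

theorem sum_sourceLaw (S : Model U X Y W) :
    ∑ p : Codebook X W n K × (Fin B → Fin n → U), sourceLaw S p = 1 := by
  have hu : ∑ u : Fin B → Fin n → U, ∏ b, ∏ t, S.PU (u b t) = 1 := by
    rw [← Fintype.prod_sum fun (_ : Fin B) (u : Fin n → U) => ∏ t, S.PU (u t)]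
    refine Finset.prod_eq_one fun _ _ => ?_
    rw [← Fintype.prod_sum fun (_ : Fin n) (u : U) => S.PU u]
    exact Finset.prod_eq_one fun _ _ => S.PU_mem.2
  rw [Fintype.sum_prod_type]
  simp only [sourceLaw, ← Finset.mul_sum, hu, mul_one, sum_codebookLaw]

theorem transmissionLaw_eq (S : Model U X Y W) (ε : ℝ) (y₀ : Y) (m₁ : Fin K)
    (sel : Selection K) (c : Codebook X W n K) (u : Fin B → Fin n → U) (y : Fin B → Fin n → Y) :
    transmissionLaw S ε y₀ m₁ sel c u y = (∏ b, ∏ t, S.PU (u b t)) *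
      ∏ b : Fin B, ∏ t, S.ch (c.1 (message S ε m₁ sel c u b.val b.isLt) t)
        (prevState y₀ y b t) (y b t) := by
  simp only [transmissionLaw, Finset.prod_mul_distrib]

open Classical in
theorem expectedProb_source (S : Model U X Y W) (ε : ℝ) (y₀ : Y) (m₁ : Fin K)
    (sel : Selection K) (hn : 0 < n)
    (E : Codebook X W n K → (Fin B → Fin n → U) → Prop) :
    expectedProb S ε y₀ m₁ sel (fun c u _ => E c u) =
      ∑ p : Codebook X W n K × (Fin B → Fin n → U),
        if E p.1 p.2 then sourceLaw S p else 0 := by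
  rw [Fintype.sum_prod_type, expectedProb]
  refine Finset.sum_congr rfl fun c _ => ?_
  rw [Finset.mul_sum]
  refine Finset.sum_congr rfl fun u _ => ?_
  split_ifs
  · simp only [transmissionLaw_eq, sourceLaw]
    rw [← Finset.mul_sum, sum_channel_eq_one S y₀ hn
      (fun b => c.1 (message S ε m₁ sel c u b.val b.isLt)), mul_one]
  · simp

/-! ### Averaging over permutations and the union bound -/

open Classical in
/-- The probability, summed over the initial states of the block, that the word `x'` is typical
with the outputs for the input word `x`. -/
def mismatchProb (S : Model U X Y W) (ε : ℝ) (x x' : Fin n → X) : ℝ :=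
  ∑ s, ∑ z, if Typical ε S.lawYXY (fun t => (stateFrom s z t, x' t, z t))
    then blockKernel S x s z else 0

theorem mismatchProb_nonneg (S : Model U X Y W) (ε : ℝ) (x x' : Fin n → X) :
    0 ≤ mismatchProb S ε x x' :=
  Finset.sum_nonneg fun s _ => Finset.sum_nonneg fun z _ => by
    split_ifs
    exacts [blockKernel_nonneg _ _ _ _, le_rfl]

-- The output law involves only the unpermuted `x`, so for fixed initial state and outputs one
-- merely counts permutations; the kernel then sums to one and the states give `|Y|`.
open Classical in
theorem sum_perm_mismatchProb_le (S : Model U X Y W) (ε : ℝ) {T : ℝ} (x x' : Fin n → X)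
    (hT : ∀ v z : Fin n → Y, ((Finset.univ.filter fun σ : Equiv.Perm (Fin n) =>
      Typical ε S.lawYXY fun t => (v t, x' (σ t), z t)).card : ℝ) ≤ T) :
    ∑ σ : Equiv.Perm (Fin n), mismatchProb S ε x (x' ∘ σ) ≤ Fintype.card Y * T := by
  simp only [mismatchProb, Function.comp_apply]
  rw [Finset.sum_comm]
  calc _ ≤ ∑ s : Y, T := Finset.sum_le_sum fun s _ => ?_
    _ = _ := by simp
  rw [Finset.sum_comm]
  calc _ ≤ ∑ z, T * blockKernel S x s z := Finset.sum_le_sum fun z _ => ?_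
    _ = T := by rw [← Finset.mul_sum, sum_blockKernel, mul_one]
  rw [← Finset.sum_filter, Finset.sum_const, nsmul_eq_mul]
  exact mul_le_mul_of_nonneg_right (hT _ z) (blockKernel_nonneg S x s z)

open Classical in
theorem sum_mismatch_le (S : Model U X Y W) (ε : ℝ) (m₁ : Fin K) (sel : Selection K)
    {ρ : ℝ} (hρ : ∀ x x' : Fin n → X,
      ∑ σ : Equiv.Perm (Fin n), mismatchProb S ε x (x' ∘ σ) ≤ ρ * n.factorial)
    (b : ℕ) (hb : b + 1 < B) (Q : Fin K → Prop) (m' : Fin K) :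
    (∑ p : Codebook X W n K × (Fin B → Fin n → U),
      if Q (message S ε m₁ sel p.1 p.2 b (Nat.lt_of_succ_lt hb)) ∧
          m' ≠ message S ε m₁ sel p.1 p.2 (b + 1) hb then
        sourceLaw S p *
          mismatchProb S ε (p.1.1 (message S ε m₁ sel p.1 p.2 (b + 1) hb)) (p.1.1 m')
      else 0) ≤
    ρ * ∑ p : Codebook X W n K × (Fin B → Fin n → U),
      if Q (message S ε m₁ sel p.1 p.2 b (Nat.lt_of_succ_lt hb)) then sourceLaw S p else 0 := by
  set h : Codebook X W n K × (Fin B → Fin n → U) → ℝ := fun p =>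
    if Q (message S ε m₁ sel p.1 p.2 b (Nat.lt_of_succ_lt hb)) ∧
        m' ≠ message S ε m₁ sel p.1 p.2 (b + 1) hb then
      sourceLaw S p *
        mismatchProb S ε (p.1.1 (message S ε m₁ sel p.1 p.2 (b + 1) hb)) (p.1.1 m')
    else 0 with hh
  have hf : (0 : ℝ) < n.factorial := by exact_mod_cast n.factorial_pos
  -- Because `m'` is not the message sent in block `b + 1`, the transmitted word stays fixed and
  -- only the competing word is permuted.
  have hinv : ∀ (σ : Equiv.Perm (Fin n)) (p : Codebook X W n K × (Fin B → Fin n → U)),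
      h (permEquiv S ε m₁ sel σ m' p) =
        if Q (message S ε m₁ sel p.1 p.2 b (Nat.lt_of_succ_lt hb)) ∧
            m' ≠ message S ε m₁ sel p.1 p.2 (b + 1) hb then
          sourceLaw S p *
            mismatchProb S ε (p.1.1 (message S ε m₁ sel p.1 p.2 (b + 1) hb)) (p.1.1 m' ∘ σ)
        else 0 := by
    intro σ p
    have hmsg : ∀ i hi, message S ε m₁ sel (permEquiv S ε m₁ sel σ m' p).1
        (permEquiv S ε m₁ sel σ m' p).2 i hi = message S ε m₁ sel p.1 p.2 i hi :=
      fun i hi => message_perm S ε m₁ sel σ m' p.1 p.2 i hi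
    simp only [hh, hmsg, sourceLaw_permEquiv]
    refine if_ctx_congr Iff.rfl (fun hc => ?_) fun _ => rfl
    simp only [permEquiv, Equiv.coe_fn_mk, permRow, Function.update_self,
      Function.update_of_ne hc.2.symm]
  -- Each permutation acts bijectively, so the sum equals its average over all `n!` of them.
  have hsum : (n.factorial : ℝ) * ∑ p, h p =
      ∑ p, ∑ σ : Equiv.Perm (Fin n), h (permEquiv S ε m₁ sel σ m' p) := by
    rw [Finset.sum_comm]
    simp only [Equiv.sum_comp]
    rw [Finset.sum_const, Finset.card_univ, Fintype.card_perm, Fintype.card_fin, nsmul_eq_mul]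
  refine le_of_mul_le_mul_left ?_ hf
  rw [hsum, ← mul_assoc, Finset.mul_sum]
  refine Finset.sum_le_sum fun p _ => ?_
  simp only [hinv]
  have hρ0 : 0 ≤ ρ := by
    by_contra hneg
    have h1 := hρ (p.1.1 m') (p.1.1 m')
    have h2 : 0 ≤ ∑ σ : Equiv.Perm (Fin n), mismatchProb S ε (p.1.1 m') (p.1.1 m' ∘ σ) :=
      Finset.sum_nonneg fun σ _ => mismatchProb_nonneg S ε _ _
    nlinarith
  by_cases hc : Q (message S ε m₁ sel p.1 p.2 b (Nat.lt_of_succ_lt hb)) ∧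
      m' ≠ message S ε m₁ sel p.1 p.2 (b + 1) hb
  · simp only [if_pos hc, if_pos hc.1]
    rw [← Finset.mul_sum, mul_comm (sourceLaw S p)]
    refine mul_le_mul_of_nonneg_right ?_ (sourceLaw_nonneg S p)
    rw [mul_comm (n.factorial : ℝ)]
    exact hρ _ _
  · simp only [if_neg hc, Finset.sum_const_zero]
    split_ifs
    · have := sourceLaw_nonneg S p
      positivity
    · simp

open Classical in
theorem expectedProb_confusion_le (S : Model U X Y W) (ε : ℝ) (y₀ : Y) (m₁ : Fin K)
    (sel : Selection K) (hn : 0 < n) {ρ : ℝ} (hρ : ∀ x x' : Fin n → X,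
      ∑ σ : Equiv.Perm (Fin n), mismatchProb S ε x (x' ∘ σ) ≤ ρ * n.factorial)
    (b : ℕ) (hb : b + 1 < B) (Q : Fin K → Prop) :
    expectedProb S ε y₀ m₁ sel (fun c (u : Fin B → Fin n → U) y =>
        Q (message S ε m₁ sel c u b (Nat.lt_of_succ_lt hb)) ∧
          confusion S ε y₀ m₁ sel b hb c u y) ≤
      K * ρ * expectedProb S ε y₀ m₁ sel (fun c (u : Fin B → Fin n → U) _ =>
        Q (message S ε m₁ sel c u b (Nat.lt_of_succ_lt hb))) := by
  rw [expectedProb_source S ε y₀ m₁ sel hn fun c u =>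
    Q (message S ε m₁ sel c u b (Nat.lt_of_succ_lt hb))]
  calc _ ≤ ∑ p : Codebook X W n K × (Fin B → Fin n → U), ∑ m' : Fin K,
        (if Q (message S ε m₁ sel p.1 p.2 b (Nat.lt_of_succ_lt hb)) ∧
            m' ≠ message S ε m₁ sel p.1 p.2 (b + 1) hb then
          sourceLaw S p *
            mismatchProb S ε (p.1.1 (message S ε m₁ sel p.1 p.2 (b + 1) hb)) (p.1.1 m')
        else 0) := ?_
    _ ≤ ∑ m' : Fin K, ρ * ∑ p : Codebook X W n K × (Fin B → Fin n → U),
        if Q (message S ε m₁ sel p.1 p.2 b (Nat.lt_of_succ_lt hb)) then sourceLaw S p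
        else 0 := by
      rw [Finset.sum_comm]
      exact Finset.sum_le_sum fun m' _ => sum_mismatch_le S ε m₁ sel hρ b hb Q m'
    _ = _ := by
      rw [Finset.sum_const, Finset.card_univ, Fintype.card_fin, nsmul_eq_mul, mul_assoc]
  rw [Fintype.sum_prod_type, expectedProb]
  refine Finset.sum_le_sum fun c _ => ?_
  rw [Finset.mul_sum]
  refine Finset.sum_le_sum fun u _ => ?_
  set P : ℝ := ∏ b, ∏ t, S.PU (u b t) with hP
  have hP0 : 0 ≤ P := Finset.prod_nonneg fun _ _ => Finset.prod_nonneg fun _ _ => S.PU_mem.1 _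
  set x : Fin B → Fin n → X := fun b => c.1 (message S ε m₁ sel c u b.val b.isLt) with hx
  by_cases hQ : Q (message S ε m₁ sel c u b (Nat.lt_of_succ_lt hb))
  swap
  · simp [hQ]
  simp only [hQ, true_and, sourceLaw, ← hP]
  set ch : (Fin B → Fin n → Y) → ℝ :=
    fun y => ∏ i, ∏ t, S.ch (x i t) (prevState y₀ y i t) (y i t) with hch
  have hch0 : ∀ y, 0 ≤ ch y := fun y =>
    Finset.prod_nonneg fun _ _ => Finset.prod_nonneg fun _ _ => (S.ch_mem _ _).1 _
  have hlaw : ∀ y, transmissionLaw S ε y₀ m₁ sel c u y = P * ch y :=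
    fun y => transmissionLaw_eq S ε y₀ m₁ sel c u y
  have hunion : ∀ y, (if confusion S ε y₀ m₁ sel b hb c u y then
      transmissionLaw S ε y₀ m₁ sel c u y else 0) ≤
      ∑ m' : Fin K, P * if m' ≠ message S ε m₁ sel c u (b + 1) hb then
        (if eventA S ε y₀ c y ⟨b + 1, hb⟩ m' then ch y else 0) else 0 := by
    intro y
    have h0 : ∀ m' : Fin K, 0 ≤ P * if m' ≠ message S ε m₁ sel c u (b + 1) hb then
        (if eventA S ε y₀ c y ⟨b + 1, hb⟩ m' then ch y else 0) else 0 := fun m' => by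
      refine mul_nonneg hP0 ?_
      split_ifs
      exacts [hch0 y, le_rfl, le_rfl]
    split_ifs with hconf
    -- The event on block `b` is dropped here.
    · obtain ⟨m', hne, hA, -⟩ := hconf
      refine le_trans (le_of_eq ?_) (Finset.single_le_sum (fun m' _ => h0 m')
        (Finset.mem_univ m'))
      rw [if_pos hne, if_pos hA, hlaw]
    · exact Finset.sum_nonneg fun m' _ => h0 m'
  refine (mul_le_mul_of_nonneg_left (Finset.sum_le_sum fun y _ => hunion y)
    (codebookLaw_nonneg S c)).trans ?_
  rw [Finset.sum_comm, Finset.mul_sum]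
  refine Finset.sum_le_sum fun m' _ => ?_
  rw [← Finset.mul_sum, ← mul_assoc]
  split_ifs with hne
  · refine mul_le_mul_of_nonneg_left ?_ (mul_nonneg (codebookLaw_nonneg S c) hP0)
    exact sum_channel_event_le S y₀ hn x ⟨b + 1, hb⟩
      fun v z => Typical ε S.lawYXY fun t => (v t, c.1 m' t, z t)
  · simp

end Symmetry

/-! ### Asymptotics and conclusion -/

/-- The exponential gap beats the polynomial factor. -/
theorem exists_numeric_bound (a k : ℕ) {d η : ℝ} (hd : 0 < d) (hη : 0 < η) :
    ∃ N₀ : ℕ, ∀ n : ℕ, N₀ ≤ n →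
      2 * a * (Real.exp 1 * n) ^ k * Real.exp (-(n * d)) ≤ η := by
  have h1 : Filter.Tendsto (fun n : ℕ => d * (n : ℝ)) Filter.atTop Filter.atTop :=
    tendsto_natCast_atTop_atTop.const_mul_atTop hd
  have h2 := ((Real.tendsto_pow_mul_exp_neg_atTop_nhds_zero k).comp h1).const_mul
    (2 * a * (Real.exp 1 / d) ^ k)
  rw [mul_zero] at h2
  obtain ⟨N₀, h⟩ := Filter.eventually_atTop.mp (h2.eventually (gt_mem_nhds hη))
  refine ⟨N₀, fun n hn => le_trans (le_of_eq ?_) (h n hn).le⟩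
  simp only [Function.comp_apply]
  rw [mul_pow, mul_pow, div_pow, mul_comm (n : ℝ) d]
  field_simp

end BlockMarkov

theorem mainTheorem4 {U X Y W : Type*} [Fintype U] [Fintype X] [Fintype Y] [Fintype W]
    (S : BlockMarkov.Model U X Y W) (R δ : ℝ) (hR : 0 < R) (hδ : 0 < δ)
    (hRI : R ≤ BlockMarkov.condMutualInfo S.lawYXY - δ) :
    ∃ ε₀ : ℝ, 0 < ε₀ ∧ ∀ ε : ℝ, 0 < ε → ε < ε₀ →
      ∀ η : ℝ, 0 < η → ∃ N₀ : ℕ, ∀ n : ℕ, N₀ ≤ n →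
        ∀ (B b : ℕ) (hb : b + 1 < B) (y₀ : Y)
          (m₁ : Fin ⌈(2 : ℝ) ^ ((n : ℝ) * R)⌉₊)
          (sel : BlockMarkov.Selection ⌈(2 : ℝ) ^ ((n : ℝ) * R)⌉₊), sel.Valid →
          BlockMarkov.expectedProb S ε y₀ m₁ sel
              (fun c (u : Fin B → Fin n → U) y =>
                BlockMarkov.confusion S ε y₀ m₁ sel b hb c u y) ≤ η ∧
          ∀ μ : Fin ⌈(2 : ℝ) ^ ((n : ℝ) * R)⌉₊,
            BlockMarkov.expectedProb S ε y₀ m₁ sel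
                (fun c (u : Fin B → Fin n → U) y =>
                  BlockMarkov.message S ε m₁ sel c u b (Nat.lt_of_succ_lt hb) = μ ∧
                    BlockMarkov.confusion S ε y₀ m₁ sel b hb c u y) ≤
              η * BlockMarkov.expectedProb S ε y₀ m₁ sel
                (fun c (u : Fin B → Fin n → U) (_ : Fin B → Fin n → Y) =>
                  BlockMarkov.message S ε m₁ sel c u b (Nat.lt_of_succ_lt hb) = μ) := by
  classical
  have hlog2 : 0 < Real.log 2 := Real.log_pos one_lt_two
  -- The rate gap in nats is `4 * d`: the permutation count spends three parts and the fourth beats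
  -- the polynomial.
  set d : ℝ := δ * Real.log 2 / 4 with hd
  have hd0 : 0 < d := by positivity
  obtain ⟨ε₀, hε₀, hperm⟩ := S.exists_card_perm_typical_le hd0
  refine ⟨ε₀, hε₀, fun ε hε hεlt η hη => ?_⟩
  obtain ⟨N₀, hN₀⟩ :=
    BlockMarkov.exists_numeric_bound (Fintype.card Y) (Fintype.card X) hd0 hη
  refine ⟨N₀ + 1, fun n hn B b hb y₀ => ?_⟩
  have hn0 : 0 < n := by omega
  set I : ℝ := BlockMarkov.condMutualInfo S.lawYXY * Real.log 2 with hI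
  set T : ℝ := (Real.exp 1 * n) ^ Fintype.card X * Real.exp (-(n * (I - 3 * d))) with hT
  have hT0 : 0 ≤ T := by positivity
  -- Rounding up costs at most a factor two because `2 ^ (n R) ≥ 1`.
  have hKle : (⌈(2 : ℝ) ^ ((n : ℝ) * R)⌉₊ : ℝ) ≤ 2 * Real.exp (n * (R * Real.log 2)) := by
    have h1 : (1 : ℝ) ≤ (2 : ℝ) ^ ((n : ℝ) * R) :=
      Real.one_le_rpow one_le_two (by positivity)
    have h2 := (Nat.ceil_lt_add_one (by positivity : (0 : ℝ) ≤ (2 : ℝ) ^ ((n : ℝ) * R))).le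
    have h3 : (2 : ℝ) ^ ((n : ℝ) * R) = Real.exp (n * (R * Real.log 2)) := by
      rw [Real.rpow_def_of_pos two_pos]
      congr 1
      ring
    rw [h3] at h1 h2
    rw [h3]
    linarith
  generalize ⌈(2 : ℝ) ^ ((n : ℝ) * R)⌉₊ = K at hKle ⊢
  intro m₁ sel _
  have hKρ : K * (Fintype.card Y * T) ≤ η := by
    refine le_trans ?_ (hN₀ n (by omega))
    refine (mul_le_mul_of_nonneg_right hKle (by positivity)).trans ?_
    have hexp : Real.exp (n * (R * Real.log 2)) * Real.exp (-(n * (I - 3 * d))) ≤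
        Real.exp (-(n * d)) := by
      rw [← Real.exp_add]
      refine Real.exp_le_exp.mpr ?_
      have h1 : R * Real.log 2 ≤ I - 4 * d := by
        have := mul_le_mul_of_nonneg_right hRI hlog2.le
        rw [hI, hd]
        linarith
      have h2 := mul_le_mul_of_nonneg_left h1 (Nat.cast_nonneg (α := ℝ) n)
      linarith
    calc 2 * Real.exp (n * (R * Real.log 2)) * (Fintype.card Y * T)
        = 2 * Fintype.card Y * (Real.exp 1 * n) ^ Fintype.card X *
            (Real.exp (n * (R * Real.log 2)) * Real.exp (-(n * (I - 3 * d)))) := by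
          rw [hT]
          ring
      _ ≤ _ := mul_le_mul_of_nonneg_left hexp (by positivity)
  have hρ : ∀ x x' : Fin n → X, ∑ σ : Equiv.Perm (Fin n),
      BlockMarkov.mismatchProb S ε x (x' ∘ σ) ≤ Fintype.card Y * T * n.factorial := by
    intro x x'
    rw [mul_assoc]
    refine BlockMarkov.sum_perm_mismatchProb_le S ε x x' fun v z => ?_
    convert hperm ε hε hεlt n hn0 v z x'
  have key := fun Q : Fin K → Prop =>
    BlockMarkov.expectedProb_confusion_le S ε y₀ m₁ sel hn0 hρ b hb Q
  refine ⟨?_, fun μ => (key fun m => m = μ).trans (mul_le_mul_of_nonneg_right hKρ ?_)⟩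
  -- The unconditional bound is the case of the trivial event, whose total mass is one.
  · have h := key fun _ => True
    rw [BlockMarkov.expectedProb_source S ε y₀ m₁ sel hn0 fun _ _ => True] at h
    simp only [true_and, if_true, BlockMarkov.sum_sourceLaw, mul_one] at h
    exact h.trans hKρ
  · rw [BlockMarkov.expectedProb_source S ε y₀ m₁ sel hn0 fun c u =>
      BlockMarkov.message S ε m₁ sel c u b (Nat.lt_of_succ_lt hb) = μ]
    refine Finset.sum_nonneg fun p _ => ?_
    split_ifs
    exacts [BlockMarkov.sourceLaw_nonneg S p, le_rfl]

end
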